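/- Let $\mathcal S$ be the set of density operators on $\mathbb C^d$. A channel is a completely positive trace preserving linear map. Channels $D_1,\dots,D_n$ with input space $\mathbb C^d$ and output spaces $\mathcal H_1,\dots,\mathcal H_n$ are compatible if there is a channel $D$ with output space $\mathcal H_1\otimes\cdots\otimes\mathcal H_n$ such that for each $j$ and each $\varrho\in\mathcal S$ the partial trace of $D(\varrho)$ over all factors but the $j$-th is $D_j(\varrho)$. For $\mathcal S_0\subset\mathcal S$ they are $\mathcal S_0$-compatible if there are compatible channels $D_1',\dots,D_n'$ with the same input and output spaces such that $D_j'(\varrho)=D_j(\varrho)$ for all $j$ and all $\varrho\in\mathcal S_0$; otherwise they are $\mathcal S_0$-incompatible. For incompatible $D_1,\dots,D_n$, the incompatibility dimension $\chi_{incomp}(D_1,\dots,D_n)$ is the minimum of $\dim\mathit{aff}\,\mathcal S_0+1$ over all $\mathcal S_0\subset\mathcal S$ for which they are $\mathcal S_0$-incompatible, and the compatibility dimension $\chi_{comp}(D_1,\dots,D_n)$ is the maximum of $\dim\mathit{aff}\,\mathcal S_0+1$ over all $\mathcal S_0\subset\mathcal S$ for which they are $\mathcal S_0$-compatible (with $\dim\mathit{aff}\,\emptyset=-1$).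 A set $\mathcal S_0\subset\mathcal S$ is broadcastable if there is a channel $B$ from $\mathbb C^d$ to $\mathbb C^d\otimes\mathbb C^d$ such that both marginals of $B(\varrho)$ equal $\varrho$ for all $\varrho\in\mathcal S_0$. States $\varrho_1,\dots,\varrho_k$ are perfectly distinguishable if there are positive semidefinite operators $A_1,\dots,A_k$ with $\sum_i A_i=\mathbb 1$ and $\mathrm{tr}(\varrho_iA_j)=\delta_{ij}$ for all $i,j$. Let $\mathrm{id}$ be the identity channel on $\mathbb C^d$. Then, for every $\mathcal S_0\subset\mathcal S$: 1. the pair $(\mathrm{id},\mathrm{id})$ is $\mathcal S_0$-compatible if and only if $\mathcal S_0$ is broadcastable; 2. if $\mathcal S_0$ contains two noncommuting states, then $(\mathrm{id},\mathrm{id})$ is $\mathcal S_0$-incompatible; 3. if the states in $\mathcal S_0$ commute pairwise, then $\dim\mathit{aff}\,\mathcal S_0+1\le d$, that is, $\mathcal S_0$ has at most $d$ affinely independent states; 4. if $\mathcal S_0=\{\varrho_1,\dots,\varrho_k\}$ with $\varrho_1,\dots,\varrho_k$ perfectly distinguishable, then $(\mathrm{id},\mathrm{id})$ is $\mathcal S_0$-compatible.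 Moreover, if $d\ge 2$, then the pair $(\mathrm{id},\mathrm{id})$ is incompatible, and $$\chi_{incomp}(\mathrm{id},\mathrm{id})=2,\qquad \chi_{comp}(\mathrm{id},\mathrm{id})=d .$$ -/

import Mathlib

open scoped Matrix.Norms.L2Operator MatrixOrder ComplexOrder CStarAlgebra

noncomputable section

namespace QDevice

/-- The density operators on the Hilbert space `ℂ^n`, as matrices in the standard basis. -/
def states (n : Type*) [Fintype n] [DecidableEq n] : Set (Matrix n n ℂ) :=
  {ρ | ρ.PosSemidef ∧ ρ.trace = 1}

/-- A quantum channel from `ℂ^m` to `ℂ^n`: a completely positive trace preserving linear map. -/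
structure Channel (m n : Type*) [Fintype m] [DecidableEq m] [Fintype n] [DecidableEq n]
    extends Matrix m m ℂ →CP Matrix n n ℂ where
  trace_map' : ∀ A : Matrix m m ℂ, (toFun A).trace = A.trace

instance {m n : Type*} [Fintype m] [DecidableEq m] [Fintype n] [DecidableEq n] :
    CoeFun (Channel m n) (fun _ => Matrix m m ℂ → Matrix n n ℂ) :=
  ⟨fun Φ => Φ.toFun⟩

/-- The identity channel on `ℂ^n`. -/
def Channel.id (n : Type*) [Fintype n] [DecidableEq n] : Channel n n where
  toLinearMap := LinearMap.id
  map_cstarMatrix_nonneg' _ _ hM := hM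
  trace_map' _ := rfl

section Joint

variable {ι : Type*} [Fintype ι] [DecidableEq ι] {out : ι → Type*}
  [∀ i, Fintype (out i)] [∀ i, DecidableEq (out i)]

/-- The `j`-th marginal of an operator on `⨂ i, ℂ^(out i)`, that is, its partial trace over all
tensor factors but the `j`-th. The product basis of the tensor product is indexed by
`∀ i, out i`. -/
def marginal (j : ι) (M : Matrix (∀ i, out i) (∀ i, out i) ℂ) : Matrix (out j) (out j) ℂ :=
  Matrix.of fun a b => ∑ x : ∀ i, out i, if x j = a then M x (Function.update x j b) else 0

variable {n : Type*} [Fintype n] [DecidableEq n]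

/-- A finite family of channels with the same input space is compatible if the channels are the
marginals of one joint channel, whose output space is the tensor product of their outputs. -/
def Compatible (D : ∀ i, Channel n (out i)) : Prop :=
  ∃ J : Channel n (∀ i, out i), ∀ j, ∀ ρ ∈ states n, marginal j (J ρ) = D j ρ

/-- `S₀`-compatibility: some compatible channels of the same type agree with the given ones on
all states in `S₀`. -/
def CompatibleOn (S₀ : Set (Matrix n n ℂ)) (D : ∀ i, Channel n (out i)) : Prop :=
  ∃ D' : ∀ i, Channel n (out i), Compatible D' ∧ ∀ j, ∀ ρ ∈ S₀, D' j ρ = D j ρ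

open Classical in
/-- `dim aff S₀ + 1`, where the empty set has affine dimension `-1`; this is the number of
affinely independent elements of `S₀`. -/
def affineSize (S₀ : Set (Matrix n n ℂ)) : ℕ :=
  if S₀.Nonempty then Module.finrank ℝ (vectorSpan ℝ S₀) + 1 else 0

/-- `k` is the incompatibility dimension of `D`: the least `dim aff S₀ + 1` over all sets of
states `S₀` on which `D` is incompatible. -/
def IsIncompatibilityDim (D : ∀ i, Channel n (out i)) (k : ℕ) : Prop :=
  IsLeast {l | ∃ S₀ ⊆ states n, ¬ CompatibleOn S₀ D ∧ affineSize S₀ = l} k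

/-- `k` is the compatibility dimension of `D`: the greatest `dim aff S₀ + 1` over all sets of
states `S₀` on which `D` is compatible. -/
def IsCompatibilityDim (D : ∀ i, Channel n (out i)) (k : ℕ) : Prop :=
  IsGreatest {l | ∃ S₀ ⊆ states n, CompatibleOn S₀ D ∧ affineSize S₀ = l} k

/-- A set `S₀` of states is broadcastable if a channel from `ℂ^n` to `ℂ^n ⊗ ℂ^n` sends every
`ρ ∈ S₀` to a bipartite state both of whose marginals are `ρ`. -/
def Broadcastable (S₀ : Set (Matrix n n ℂ)) : Prop :=
  ∃ B : Channel n (Fin 2 → n), ∀ ρ ∈ S₀, ∀ j : Fin 2, marginal j (B ρ) = ρ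

/-- The states `ρ 1, …, ρ k` are perfectly distinguishable: an observable (POVM) with outcomes
`1, …, k` yields the outcome `i` with certainty in the state `ρ i`. -/
def PerfectlyDistinguishable {k : ℕ} (ρ : Fin k → Matrix n n ℂ) : Prop :=
  ∃ A : Fin k → Matrix n n ℂ, (∀ i, (A i).PosSemidef) ∧ ∑ i, A i = 1 ∧
    ∀ i j, (ρ i * A j).trace = if i = j then 1 else 0

end Joint

/-- The pair of two identity channels on `ℂ^d`. -/
def identityPair (d : ℕ) : ∀ _ : Fin 2, Channel (Fin d) (Fin d) :=
  fun _ => Channel.id (Fin d)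

end QDevice

end

namespace QDevice

open Matrix

/-! ### The operator-algebraic core of no-broadcasting -/

section Core

variable {n κ : Type*} [Fintype n] [DecidableEq n] [Fintype κ]

/-! The crux is the no-broadcasting theorem: states broadcast by one channel commute. Kraus
operators of the channel `B`, stacked into one matrix, give an isometry `V`, and operators on the
two output factors form commuting representations `π₀`, `π₁`. That the marginals of `B` fix `ρ` and
`σ` becomes a trace identity for each `π`. With `τ = ρ + σ`, take the quotient `X` with `τ * X = ρ =
Xᴴ * τ`. Expanding squares weighted by `τ` shows that `V` intertwines `X` and `Xᴴ` with `π X` and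
`(π X)ᴴ` on the range of `τ` (`dilation_intertwines`). Since `π₀ X` and `(π₁ X)ᴴ` commute, `X` is
normal on that range, and normality together with `τ * X = Xᴴ * τ` makes `ρ` commute with `τ`, hence
with `σ`.

The rest is a count. A marginal of a channel is a channel, so compatibility of the identities on a
set is broadcastability. Commuting states are simultaneously diagonal with real eigenvalues, so they
span real dimension at most `d`; trace one makes the affine size no larger. Measuring and preparing
`ρ i ⊗ ρ i` broadcasts distinguishable states; the basis states attain `d`. A single state is always
broadcastable, while two noncommuting states are not, whence the value 2. -/

theorem mul_eq_zero_of_trace_eq_zero {τ : Matrix n n ℂ} (hτ : τ.PosSemidef) (G : Matrix n κ ℂ)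
    (h : (Gᴴ * τ * G).trace = 0) : τ * G = 0 := by
  obtain ⟨T, rfl⟩ := CStarAlgebra.nonneg_iff_eq_star_mul_self.mp hτ.nonneg
  have h' : ((T * G)ᴴ * (T * G)).trace = 0 := by
    rw [← h, conjTranspose_mul, star_eq_conjTranspose]
    simp only [Matrix.mul_assoc]
  rw [Matrix.mul_assoc, trace_conjTranspose_mul_self_eq_zero_iff.mp h', Matrix.mul_zero]

/-- Apply `x ↦ x⁻¹` through the functional calculus. The spectrum is finite, so continuity is
automatic, and the convention `0⁻¹ = 0` handles the kernel. -/
theorem exists_pseudoinverse {τ : Matrix n n ℂ} (hτ : τ.IsHermitian) :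
    ∃ S : Matrix n n ℂ, S.IsHermitian ∧ τ * S * τ = τ ∧ τ * S = S * τ := by
  have hτ' : IsSelfAdjoint τ := hτ
  have hc : ∀ f : ℝ → ℝ, ContinuousOn f (spectrum ℝ τ) := fun f =>
    (Matrix.finite_real_spectrum (A := τ)).continuousOn f
  refine ⟨cfc (fun x : ℝ => x⁻¹) τ, cfc_predicate _ τ, ?_, ?_⟩
  · have h : cfc (fun x : ℝ => x) τ * cfc (fun x : ℝ => x⁻¹) τ * cfc (fun x : ℝ => x) τ
        = cfc (fun x : ℝ => x) τ := by
      rw [← cfc_mul _ _ τ (hc _) (hc _), ← cfc_mul _ _ τ (hc _) (hc _)]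
      exact cfc_congr fun x _ => mul_inv_mul_cancel x
    rwa [cfc_id' ℝ τ] at h
  · exact (cfc_commute_cfc (fun x : ℝ => x) (fun x : ℝ => x⁻¹) τ |>.eq |> fun h => by
      rwa [cfc_id' ℝ τ] at h)

/-- No invertibility of `ρ + σ` is needed: positivity forces its kernel into that of `ρ`, so its
pseudoinverse `S` gives `X = S * ρ`. The form `τ * R * τ` lets a factor `τ` be pulled out of `X` on
either side, which the intertwining argument requires. -/
theorem exists_density_quotient {ρ σ : Matrix n n ℂ} (hρ : ρ.PosSemidef) (hσ : σ.PosSemidef) :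
    ∃ X R : Matrix n n ℂ, (ρ + σ) * X = ρ ∧ Xᴴ * (ρ + σ) = ρ ∧
      X = (ρ + σ) * R * (ρ + σ) := by
  obtain ⟨S, hS, h1, h2⟩ := exists_pseudoinverse (hρ.add hσ).isHermitian
  have hτh : (ρ + σ)ᴴ = ρ + σ := (hρ.add hσ).isHermitian
  set τ := ρ + σ with hτ
  have hD : τ * (1 - S * τ) = 0 := by
    rw [mul_sub, mul_one, ← mul_assoc, h1, sub_self]
  have hsum : ((1 - S * τ)ᴴ * ρ * (1 - S * τ)).trace + ((1 - S * τ)ᴴ * σ * (1 - S * τ)).trace = 0 := by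
    rw [← trace_add, ← add_mul, ← mul_add, ← hτ, mul_assoc, hD, mul_zero, trace_zero]
  have hρ0 := (hρ.conjTranspose_mul_mul_same (1 - S * τ)).trace_nonneg
  have hσ0 := (hσ.conjTranspose_mul_mul_same (1 - S * τ)).trace_nonneg
  have h3 : ρ * (1 - S * τ) = 0 :=
    mul_eq_zero_of_trace_eq_zero hρ _ ((add_eq_zero_iff_of_nonneg hρ0 hσ0).mp hsum).1
  have h4 : ρ * S * τ = ρ := by
    rw [mul_sub, mul_one, sub_eq_zero, ← mul_assoc] at h3; exact h3.symm
  have h5 : τ * S * ρ = ρ := by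
    have := congrArg conjTranspose h4
    simpa only [conjTranspose_mul, hS.eq, hρ.isHermitian.eq, hτh, ← mul_assoc] using this
  refine ⟨S * ρ, S * S * ρ * S, ?_, ?_, ?_⟩
  · rw [← mul_assoc, h5]
  · rw [conjTranspose_mul, hS.eq, hρ.isHermitian.eq, h4]
  · calc S * ρ = S * (τ * S * ρ * S * τ) := by rw [h5, h4]
      _ = τ * (S * S * ρ * S) * τ := by
        simp only [← mul_assoc]; rw [h2]

variable {V : Matrix κ n ℂ} {ρ τ X R : Matrix n n ℂ}

/-- If `V` dilates a channel whose marginal along `π` fixes `τ` and `ρ = τ * X`, then `V`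
intertwines `X` with `π X`, and its adjoint, on the range of `τ`. -/
theorem dilation_intertwines (hV : Vᴴ * V = 1) (π : Matrix n n ℂ →⋆ₙₐ[ℂ] Matrix κ κ ℂ)
    (hτ : τ.PosSemidef) (hτX : τ * X = ρ) (hXτ : Xᴴ * τ = ρ) (hX : X = τ * R * τ)
    (hπτ : ∀ Q, (π Q * (V * τ * Vᴴ)).trace = (Q * τ).trace)
    (hπρ : ∀ Q, (π Q * (V * ρ * Vᴴ)).trace = (Q * ρ).trace) :
    (π X)ᴴ * V * τ = V * ρ ∧ π X * V * τ = V * X * τ := by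
  have hst : (π X)ᴴ = π Xᴴ := (map_star π X).symm
  have hτh : τᴴ = τ := hτ.isHermitian
  have hρh : ρᴴ = ρ := by rw [← hXτ, conjTranspose_mul, conjTranspose_conjTranspose, hτh, hτX, hXτ]
  have hXh : Xᴴ = τ * Rᴴ * τ := by
    conv_lhs => rw [hX]
    rw [conjTranspose_mul, conjTranspose_mul, hτh, Matrix.mul_assoc]
  have hXR : X * τ = τ * (R * τ * τ) := by
    conv_lhs => rw [hX]
    simp only [Matrix.mul_assoc]
  have hVV : ∀ A : Matrix n n ℂ, (V * A * Vᴴ).trace = A.trace := fun A => by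
    rw [Matrix.mul_assoc, trace_mul_comm, Matrix.mul_assoc, hV, Matrix.mul_one]
  -- All four terms of the square have trace `(X * ρ).trace`. The cross terms involve only `τ * X =
  -- Xᴴ * τ = ρ`, whose marginal is known.
  have key : τ * (Vᴴ * π X - X * Vᴴ) = 0 := by
    apply mul_eq_zero_of_trace_eq_zero hτ
    have e : (Vᴴ * π X - X * Vᴴ)ᴴ * τ * (Vᴴ * π X - X * Vᴴ)
        = π Xᴴ * (V * τ * Vᴴ) * π X - π Xᴴ * (V * (τ * X) * Vᴴ) - V * (Xᴴ * τ) * Vᴴ * π X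
          + V * (Xᴴ * (τ * X)) * Vᴴ := by
      simp only [conjTranspose_sub, conjTranspose_mul, conjTranspose_conjTranspose, hst,
        Matrix.sub_mul, Matrix.mul_sub, Matrix.mul_assoc]
      abel
    rw [e, trace_add, trace_sub, trace_sub, trace_mul_comm, ← Matrix.mul_assoc, ← map_mul, hπτ,
      hτX, hXτ, hπρ, trace_mul_comm _ (π X), hπρ, hVV, Matrix.mul_assoc, hXτ]
    ring
  have key1 : τ * Vᴴ * π X = ρ * Vᴴ := by
    rw [Matrix.mul_sub, sub_eq_zero] at key
    rw [Matrix.mul_assoc, key, ← Matrix.mul_assoc, hτX]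
  have key2 : (π X)ᴴ * V * τ = V * ρ := by
    have := congrArg conjTranspose key1
    simpa only [conjTranspose_mul, conjTranspose_conjTranspose, hτh, hρh, Matrix.mul_assoc]
      using this
  refine ⟨key2, ?_⟩
  -- Here the cross terms contain `τ * Xᴴ` and `X * τ`, on which the marginal is not known. Writing
  -- `X = τ * R * τ` exposes a `τ` next to `V`, so that `key1` and `key2` evaluate them.
  have key3 : τ * (Vᴴ * π Xᴴ - Xᴴ * Vᴴ) = 0 := by
    apply mul_eq_zero_of_trace_eq_zero hτ
    have e : (Vᴴ * π Xᴴ - Xᴴ * Vᴴ)ᴴ * τ * (Vᴴ * π Xᴴ - Xᴴ * Vᴴ)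
        = π X * (V * τ * Vᴴ) * π Xᴴ - π X * V * (τ * Xᴴ * Vᴴ) - V * (X * τ) * (Vᴴ * π Xᴴ)
          + V * (X * τ * Xᴴ) * Vᴴ := by
      simp only [← hst, conjTranspose_sub, conjTranspose_mul, conjTranspose_conjTranspose,
        Matrix.sub_mul, Matrix.mul_sub, Matrix.mul_assoc]
      abel
    have e2 : τ * Xᴴ * Vᴴ * (π X * V) = τ * Xᴴ * X := by
      rw [hXh]
      calc _ = τ * (τ * Rᴴ) * (τ * Vᴴ * π X) * V := by simp only [Matrix.mul_assoc]
        _ = τ * (τ * Rᴴ) * (τ * X) := by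
          rw [key1, Matrix.mul_assoc, Matrix.mul_assoc ρ, hV, Matrix.mul_one, hτX]
        _ = _ := by simp only [Matrix.mul_assoc]
    have e3 : Vᴴ * π Xᴴ * (V * (X * τ)) = Xᴴ * X * τ := by
      calc _ = Vᴴ * ((π X)ᴴ * V * τ) * (R * τ * τ) := by
            rw [hst, hXR]; simp only [Matrix.mul_assoc]
        _ = Xᴴ * (τ * R * τ) * τ := by
          rw [key2, ← Matrix.mul_assoc Vᴴ, hV, Matrix.one_mul, ← hXτ]
          simp only [Matrix.mul_assoc]
        _ = _ := by rw [← hX]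
    rw [e, trace_add, trace_sub, trace_sub, trace_mul_comm, ← Matrix.mul_assoc, ← map_mul, hπτ,
      trace_mul_comm (π X * V), e2, trace_mul_comm _ (Vᴴ * π Xᴴ), e3, hVV,
      Matrix.mul_assoc τ, trace_mul_comm τ, trace_mul_comm (X * τ), ← Matrix.mul_assoc]
    ring
  have := congrArg conjTranspose key3
  simp only [conjTranspose_mul, conjTranspose_sub, conjTranspose_conjTranspose, hτh,
    conjTranspose_zero, ← hst, Matrix.sub_mul, sub_eq_zero] at this
  exact this

/-- A Fuglede-type argument: normality on the range of `τ` turns `τ * X = Xᴴ * τ` into `τ * Xᴴ = X *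
τ`, because the four traces in the square of the difference coincide. -/
theorem commute_of_normal_quotient (hτ : τ.PosSemidef) (hτX : τ * X = ρ) (hXτ : Xᴴ * τ = ρ)
    (hN : Xᴴ * X * τ = X * Xᴴ * τ) : Commute ρ τ := by
  have hτh : τᴴ = τ := hτ.isHermitian
  have hc : τ * X = Xᴴ * τ := hτX.trans hXτ.symm
  have hF : τ * Xᴴ - X * τ = 0 := by
    rw [← trace_conjTranspose_mul_self_eq_zero_iff]
    have e : (τ * Xᴴ - X * τ)ᴴ * (τ * Xᴴ - X * τ)
        = X * (τ * τ * Xᴴ) - X * τ * (X * τ) - τ * Xᴴ * (τ * Xᴴ) + τ * (Xᴴ * X * τ) := by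
      simp only [conjTranspose_sub, conjTranspose_mul, conjTranspose_conjTranspose, hτh]
      noncomm_ring
    have e1 : (X * (τ * τ * Xᴴ)).trace = (τ * (Xᴴ * X * τ)).trace := by
      rw [trace_mul_comm, trace_mul_comm τ, mul_assoc, trace_mul_comm]
      congr 1; noncomm_ring
    have e2 : τ * (X * Xᴴ * τ) = τ * X * (τ * X) := by
      rw [mul_assoc X, ← hc]; noncomm_ring
    have e3 : τ * (X * Xᴴ * τ) = Xᴴ * τ * (Xᴴ * τ) := by
      rw [← hc, mul_assoc X, ← hc]; noncomm_ring
    have e4 : (X * τ * (X * τ)).trace = (τ * (X * Xᴴ * τ)).trace := by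
      rw [e2, mul_assoc, trace_mul_comm]; congr 1; noncomm_ring
    have e5 : (τ * Xᴴ * (τ * Xᴴ)).trace = (τ * (X * Xᴴ * τ)).trace := by
      rw [e3, mul_assoc, trace_mul_comm]; congr 1; noncomm_ring
    rw [e, trace_add, trace_sub, trace_sub, e1, e4, e5, hN]
    ring
  have hF' : τ * Xᴴ = X * τ := sub_eq_zero.mp hF
  -- The skew-Hermitian `X - Xᴴ` anticommutes with `τ`; together with cyclicity of the trace, this
  -- makes its `τ`-weighted square equal to its own negative.
  have hH : τ * (X - Xᴴ) = 0 := by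
    apply mul_eq_zero_of_trace_eq_zero hτ
    have a1 : τ * (X - Xᴴ) = -((X - Xᴴ) * τ) := by
      rw [mul_sub, sub_mul, hc, hF']; abel
    have a2 : (X - Xᴴ)ᴴ = -(X - Xᴴ) := by
      rw [conjTranspose_sub, conjTranspose_conjTranspose]; abel
    have a3 : ((X - Xᴴ)ᴴ * τ * (X - Xᴴ)).trace = -(τ * (X - Xᴴ) * (X - Xᴴ)).trace := by
      rw [a2, neg_mul, neg_mul, trace_neg, mul_assoc, trace_mul_comm]
    have a4 : ((X - Xᴴ)ᴴ * τ * (X - Xᴴ)).trace = (τ * (X - Xᴴ) * (X - Xᴴ)).trace := by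
      rw [a2, a1]; congr 1; noncomm_ring
    linear_combination (a3 + a4) / 2
  rw [mul_sub, sub_eq_zero, hF', hτX] at hH
  have h1 : τ * ρ = τ * X * τ := by rw [hH, mul_assoc]
  rw [Commute, SemiconjBy, h1, hτX]

/-- Evaluating `(π₁ X)ᴴ * π₀ X * V * τ` in both orders gives `V * (Xᴴ * X * τ)` and `V * (X * Xᴴ *
τ)`; the isometry `V` cancels. -/
theorem commute_of_commuting_dilations (hV : Vᴴ * V = 1)
    (π₀ π₁ : Matrix n n ℂ →⋆ₙₐ[ℂ] Matrix κ κ ℂ) (hπ : ∀ Q S, Commute (π₀ Q) (π₁ S))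
    {σ : Matrix n n ℂ} (hρ : ρ.PosSemidef) (hσ : σ.PosSemidef)
    (h₀ρ : ∀ Q, (π₀ Q * (V * ρ * Vᴴ)).trace = (Q * ρ).trace)
    (h₁ρ : ∀ Q, (π₁ Q * (V * ρ * Vᴴ)).trace = (Q * ρ).trace)
    (h₀σ : ∀ Q, (π₀ Q * (V * σ * Vᴴ)).trace = (Q * σ).trace)
    (h₁σ : ∀ Q, (π₁ Q * (V * σ * Vᴴ)).trace = (Q * σ).trace) : Commute ρ σ := by
  obtain ⟨X, R, hτX, hXτ, hX⟩ := exists_density_quotient hρ hσ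
  have hadd : ∀ π : Matrix n n ℂ →⋆ₙₐ[ℂ] Matrix κ κ ℂ,
      (∀ Q, (π Q * (V * ρ * Vᴴ)).trace = (Q * ρ).trace) →
      (∀ Q, (π Q * (V * σ * Vᴴ)).trace = (Q * σ).trace) →
      ∀ Q, (π Q * (V * (ρ + σ) * Vᴴ)).trace = (Q * (ρ + σ)).trace := fun π h h' Q => by
    rw [Matrix.mul_add, Matrix.add_mul, Matrix.mul_add, trace_add, h, h', mul_add, trace_add]
  have hτ := hρ.add hσ
  obtain ⟨-, b₀⟩ := dilation_intertwines hV π₀ hτ hτX hXτ hX (hadd π₀ h₀ρ h₀σ) h₀ρ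
  obtain ⟨a₁, -⟩ := dilation_intertwines hV π₁ hτ hτX hXτ hX (hadd π₁ h₁ρ h₁σ) h₁ρ
  set τ := ρ + σ with hτdef
  have hXR : X * τ = τ * (R * τ * τ) := by
    conv_lhs => rw [hX]
    simp only [Matrix.mul_assoc]
  have hcomm : (π₁ X)ᴴ * π₀ X = π₀ X * (π₁ X)ᴴ := by
    have := (hπ X Xᴴ).eq
    rw [show π₁ Xᴴ = (π₁ X)ᴴ from map_star π₁ X] at this
    exact this.symm
  have e1 : (π₁ X)ᴴ * π₀ X * V * τ = V * (Xᴴ * X * τ) := by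
    calc _ = (π₁ X)ᴴ * (π₀ X * V * τ) := by simp only [Matrix.mul_assoc]
      _ = (π₁ X)ᴴ * V * τ * (R * τ * τ) := by
        rw [b₀, Matrix.mul_assoc V, hXR]; simp only [Matrix.mul_assoc]
      _ = V * (Xᴴ * (τ * R * τ) * τ) := by
        rw [a₁, ← hXτ]; simp only [Matrix.mul_assoc]
      _ = _ := by rw [← hX]
  have e2 : (π₁ X)ᴴ * π₀ X * V * τ = V * (X * Xᴴ * τ) := by
    calc _ = π₀ X * ((π₁ X)ᴴ * V * τ) := by rw [hcomm]; simp only [Matrix.mul_assoc]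
      _ = π₀ X * V * τ * X := by rw [a₁, ← hτX]; simp only [Matrix.mul_assoc]
      _ = V * (X * (τ * X)) := by rw [b₀]; simp only [Matrix.mul_assoc]
      _ = _ := by rw [hτX, Matrix.mul_assoc X, hXτ]
  have hN : Xᴴ * X * τ = X * Xᴴ * τ := by
    have := congrArg (Vᴴ * ·) (e1.symm.trans e2)
    simpa only [← Matrix.mul_assoc, hV, Matrix.one_mul] using this
  have h := commute_of_normal_quotient hτ hτX hXτ hN
  simpa [hτdef] using h.sub_right (Commute.refl ρ)

end Core
-- Kraus decompositions and complete positivity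
section Kraus

variable {m n κ : Type*} [Fintype m] [DecidableEq m] [Fintype n] [DecidableEq n] [Fintype κ]

theorem exists_mul_star_mul_eq_one {N : ℕ} (hN : N ≠ 0) : ∃ w : ℂ, N * (star w * w) = 1 := by
  refine ⟨((Real.sqrt N)⁻¹ : ℝ), ?_⟩
  have h : (Real.sqrt N)⁻¹ * (Real.sqrt N)⁻¹ = (N : ℝ)⁻¹ := by
    rw [← mul_inv, Real.mul_self_sqrt (Nat.cast_nonneg N)]
  have hN' : (N : ℂ) ≠ 0 := Nat.cast_ne_zero.mpr hN
  rw [Complex.star_def, Complex.conj_ofReal, ← Complex.ofReal_mul, h]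
  push_cast
  exact mul_inv_cancel₀ hN'

theorem exists_eq_star_mul_self_of_nonneg {A : Type*} [NonUnitalCStarAlgebra A] [PartialOrder A]
    [StarOrderedRing A] {a : A} (ha : 0 ≤ a) : ∃ b, a = star b * b :=
  CStarAlgebra.nonneg_iff_eq_star_mul_self.mp ha

/-- Every channel has a Kraus decomposition. -/
theorem Channel.exists_kraus (Φ : Channel m n) :
    ∃ K : m × n → Matrix n m ℂ, ∀ A, Φ A = ∑ x, K x * A * (K x)ᴴ := by
  rcases isEmpty_or_nonempty m with hm | hm
  · refine ⟨fun _ => 0, fun A => ?_⟩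
    have hA : A = 0 := Subsingleton.elim _ _
    have h0 : Φ.toFun 0 = 0 := map_zero Φ.toLinearMap
    simp [hA, h0]
  obtain ⟨w, hw⟩ := exists_mul_star_mul_eq_one (Fintype.card_ne_zero (α := m))
  -- `M` is the Choi block matrix of matrix units. The scalar `w` compensates for the `Fintype.card
  -- m` equal summands in `star N * N`.
  let M : CStarMatrix m m (Matrix m m ℂ) := CStarMatrix.ofMatrix fun i j => single i j 1
  let N : CStarMatrix m m (Matrix m m ℂ) := CStarMatrix.ofMatrix fun i j => w • single i j 1
  have hM : M = star N * N := by
    apply CStarMatrix.ext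
    intro i j
    rw [CStarMatrix.mul_apply]
    change single i j (1 : ℂ) = ∑ k, (w • single k i (1 : ℂ))ᴴ * (w • single k j (1 : ℂ))
    simp only [conjTranspose_smul, conjTranspose_single, star_one, smul_mul_smul_comm,
      single_mul_single_same, mul_one, Finset.sum_const, Finset.card_univ]
    rw [← Nat.cast_smul_eq_nsmul ℂ, smul_smul, hw, one_smul]
  have hpos := Φ.toCompletelyPositiveMap.map_cstarMatrix_nonneg M (hM ▸ star_mul_self_nonneg N)
  obtain ⟨L, hL⟩ := exists_eq_star_mul_self_of_nonneg hpos
  have hE : ∀ i j, Φ (single i j 1) = ∑ k, (L k i)ᴴ * L k j := fun i j => by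
    have := congrFun (congrFun hL i) j
    rw [CStarMatrix.mul_apply] at this
    exact this
  refine ⟨fun x => of fun a i => star (L x.1 i x.2 a), fun A => ?_⟩
  have hA : Φ A = ∑ i, ∑ j, A i j • Φ (single i j 1) := by
    have h1 : A = ∑ i, ∑ j, A i j • single i j (1 : ℂ) := by
      conv_lhs => rw [matrix_eq_sum_single A]
      simp
    change Φ.toLinearMap A = ∑ i, ∑ j, A i j • Φ.toLinearMap (single i j 1)
    conv_lhs => rw [h1]
    simp only [map_sum, map_smul]
  rw [hA]
  ext a b
  simp only [hE, Matrix.sum_apply, Matrix.smul_apply, Matrix.mul_apply, conjTranspose_apply,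
    of_apply, star_star, Fintype.sum_prod_type, smul_eq_mul, Finset.mul_sum, Finset.sum_mul]
  have e1 : ∀ f : m → m → m → n → ℂ,
      ∑ i, ∑ j, ∑ k, ∑ c, f i j k c = ∑ k, ∑ c, ∑ j, ∑ i, f i j k c := fun f => by
    calc _ = ∑ j, ∑ i, ∑ k, ∑ c, f i j k c := Finset.sum_comm
      _ = ∑ j, ∑ k, ∑ i, ∑ c, f i j k c := Finset.sum_congr rfl fun j _ => Finset.sum_comm
      _ = ∑ k, ∑ j, ∑ i, ∑ c, f i j k c := Finset.sum_comm
      _ = ∑ k, ∑ j, ∑ c, ∑ i, f i j k c := Finset.sum_congr rfl fun k _ =>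
        Finset.sum_congr rfl fun j _ => Finset.sum_comm
      _ = _ := Finset.sum_congr rfl fun k _ => Finset.sum_comm
  rw [e1]
  refine Finset.sum_congr rfl fun k _ => Finset.sum_congr rfl fun c _ =>
    Finset.sum_congr rfl fun j _ => Finset.sum_congr rfl fun i _ => ?_
  ring

theorem nonneg_of_gram {k : ℕ} (G : CStarMatrix (Fin k) (Fin k) (Matrix n n ℂ))
    (r : κ → Fin k → n → ℂ) (h : ∀ i j a b, G i j a b = ∑ x, star (r x i a) * r x j b) :
    0 ≤ G := by
  -- Each Gram vector is copied into all `k * Fintype.card n` rows of `R x`, so normalising by `w`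
  -- needs this count to be nonzero.
  by_cases hk : k * Fintype.card n = 0
  · have : G = 0 := by
      apply CStarMatrix.ext
      intro i j
      ext a b
      rcases Nat.mul_eq_zero.mp hk with h0 | h0
      · subst h0; exact i.elim0
      · exact ((Fintype.card_eq_zero_iff.mp h0).false a).elim
    exact this.ge
  obtain ⟨w, hw⟩ := exists_mul_star_mul_eq_one hk
  let R : κ → CStarMatrix (Fin k) (Fin k) (Matrix n n ℂ) := fun x =>
    CStarMatrix.ofMatrix fun _ j => of fun _ b => w * r x j b
  have hG : G = ∑ x, star (R x) * R x := by
    have hs : ∀ (s : Finset κ) i j, (∑ x ∈ s, star (R x) * R x) i j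
        = ∑ x ∈ s, (star (R x) * R x) i j := by
      classical
      intro s i j
      induction s using Finset.induction_on with
      | empty => rfl
      | insert x s hx ih => rw [Finset.sum_insert hx, Finset.sum_insert hx, ← ih]; rfl
    apply CStarMatrix.ext
    intro i j
    ext a b
    rw [hs, h, Matrix.sum_apply]
    refine Finset.sum_congr rfl fun x _ => ?_
    rw [CStarMatrix.mul_apply]
    change _ = (∑ _ : Fin k, (of fun (_ : n) b => w * r x i b)ᴴ *
      (of fun (_ : n) b => w * r x j b)) a b
    simp only [Matrix.sum_apply, Matrix.mul_apply, conjTranspose_apply, of_apply,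
      Finset.sum_const, Finset.card_univ, Fintype.card_fin, star_mul', nsmul_eq_mul]
    push_cast at hw
    linear_combination (- star (r x i a) * r x j b) * hw
  rw [hG]
  exact Finset.sum_nonneg fun x _ => star_mul_self_nonneg (R x)

/-- The channel with given Kraus operators. -/
def Channel.ofKraus (K : κ → Matrix n m ℂ) (hK : ∑ x, (K x)ᴴ * K x = 1) : Channel m n where
  toFun A := ∑ x, K x * A * (K x)ᴴ
  map_add' A B := by simp only [Matrix.mul_add, Matrix.add_mul, Finset.sum_add_distrib]
  map_smul' c A := by
    simp only [Matrix.mul_smul, Matrix.smul_mul, Finset.smul_sum, RingHom.id_apply]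
  map_cstarMatrix_nonneg' k M hM := by
    obtain ⟨N, rfl⟩ := exists_eq_star_mul_self_of_nonneg hM
    apply nonneg_of_gram _ (fun (y : κ × Fin k × m) j b => (N y.2.1 j * (K y.1)ᴴ) y.2.2 b)
    intro i j a b
    have e : (CStarMatrix.map (star N * N) fun A => ∑ x, K x * A * (K x)ᴴ) i j
        = ∑ x, ∑ l, (N l i * (K x)ᴴ)ᴴ * (N l j * (K x)ᴴ) := by
      rw [CStarMatrix.map_apply, CStarMatrix.mul_apply]
      simp only [CStarMatrix.star_apply, star_eq_conjTranspose, conjTranspose_mul,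
        conjTranspose_conjTranspose, Matrix.mul_sum, Matrix.sum_mul, Matrix.mul_assoc]
    refine (congrFun (congrFun e a) b).trans ?_
    simp only [Matrix.sum_apply, Fintype.sum_prod_type]
    refine Finset.sum_congr rfl fun x _ => Finset.sum_congr rfl fun l _ => ?_
    rw [Matrix.mul_apply]
    rfl
  trace_map' A := by
    simp only [trace_sum, trace_mul_comm _ (K _)ᴴ, ← Matrix.mul_assoc]
    rw [← trace_sum, ← Matrix.sum_mul, hK, Matrix.one_mul]

theorem eq_one_of_trace_mul_eq {P : Matrix m m ℂ} (h : ∀ A, (P * A).trace = A.trace) : P = 1 := by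
  ext i j
  have := h (single j i 1)
  by_cases hij : i = j
  · subst hij; simpa [trace_mul_single] using this
  · simpa [trace_mul_single, Matrix.one_apply, hij, trace_single_eq_of_ne _ _ _ (Ne.symm hij)]
      using this

omit [DecidableEq n] in
theorem sum_conjTranspose_mul_eq_one (K : κ → Matrix n m ℂ)
    (h : ∀ A : Matrix m m ℂ, (∑ x, K x * A * (K x)ᴴ).trace = A.trace) :
    ∑ x, (K x)ᴴ * K x = 1 := by
  apply eq_one_of_trace_mul_eq
  intro A
  rw [← h A, Matrix.sum_mul, trace_sum, trace_sum]
  refine Finset.sum_congr rfl fun x _ => ?_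
  rw [trace_mul_comm _ (K x)ᴴ, Matrix.mul_assoc]

end Kraus
-- Partial traces and compatibility on a set
section Marginal

variable {ι : Type*} [Fintype ι] [DecidableEq ι] {out : ι → Type*}
  [∀ i, Fintype (out i)] [∀ i, DecidableEq (out i)]

theorem marginal_apply (j : ι) (M : Matrix (∀ i, out i) (∀ i, out i) ℂ) (a b : out j) :
    marginal j M a b = ∑ y, M ((Equiv.piSplitAt j out).symm (a, y))
      ((Equiv.piSplitAt j out).symm (b, y)) := by
  have hu : ∀ c y, Function.update ((Equiv.piSplitAt j out).symm (c, y)) j b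
      = (Equiv.piSplitAt j out).symm (b, y) := fun c y => by
    ext i
    by_cases h : i = j
    · subst h; simp
    · simp [h]
  rw [marginal, of_apply, ← (Equiv.piSplitAt j out).symm.sum_comp, Fintype.sum_prod_type,
    Finset.sum_comm]
  refine Finset.sum_congr rfl fun y _ => ?_
  simp only [hu]
  simp

theorem trace_marginal (j : ι) (M : Matrix (∀ i, out i) (∀ i, out i) ℂ) :
    (marginal j M).trace = M.trace := by
  simp only [trace, diag, marginal_apply]
  rw [← Fintype.sum_prod_type', ← (Equiv.piSplitAt j out).symm.sum_comp]

/-- Kraus operators of the partial trace over all factors but the `j`-th. -/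
def marginalKraus (j : ι) (y : ∀ i : {i // i ≠ j}, out i) : Matrix (out j) (∀ i, out i) ℂ :=
  (1 : Matrix (∀ i, out i) (∀ i, out i) ℂ).submatrix
    (fun a => (Equiv.piSplitAt j out).symm (a, y)) id

theorem marginal_eq_sum_kraus (j : ι) (M : Matrix (∀ i, out i) (∀ i, out i) ℂ) :
    marginal j M = ∑ y : (∀ i : {i // i ≠ j}, out i),
      (marginalKraus j y * M : Matrix (out j) (∀ i, out i) ℂ) * (marginalKraus j y)ᴴ := by
  ext a b
  rw [marginal_apply, Matrix.sum_apply]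
  refine Finset.sum_congr rfl fun y _ => ?_
  simp only [Matrix.mul_apply, marginalKraus, conjTranspose_apply, submatrix_apply, id_eq,
    one_apply]
  simp [Finset.sum_ite_eq]

variable {n : Type*} [Fintype n] [DecidableEq n]

theorem exists_marginal_channel (J : Channel n (∀ i, out i)) (j : ι) :
    ∃ Φ : Channel n (out j), ∀ A, Φ A = marginal j (J A) := by
  obtain ⟨K, hK⟩ := J.exists_kraus
  have h : ∀ A, marginal j (J A) = ∑ x : (∀ i : {i // i ≠ j}, out i) × (n × (∀ i, out i)),
      (marginalKraus j x.1 * K x.2) * A * (marginalKraus j x.1 * K x.2)ᴴ := fun A => by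
    rw [hK, marginal_eq_sum_kraus]
    simp only [Fintype.sum_prod_type, Matrix.mul_sum, Matrix.sum_mul, conjTranspose_mul, Matrix.mul_assoc]
  refine ⟨Channel.ofKraus _ (sum_conjTranspose_mul_eq_one _ fun A => ?_), fun A => (h A).symm⟩
  rw [← h, trace_marginal, J.trace_map']

/-- The auxiliary channels `D'` can be dropped, since the marginals of any joint channel serve as
them. -/
theorem compatibleOn_iff {S₀ : Set (Matrix n n ℂ)} (hS : S₀ ⊆ states n)
    (D : ∀ i, Channel n (out i)) :
    CompatibleOn S₀ D ↔ ∃ J : Channel n (∀ i, out i), ∀ j, ∀ ρ ∈ S₀, marginal j (J ρ) = D j ρ := by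
  constructor
  · rintro ⟨D', ⟨J, hJ⟩, hD⟩
    exact ⟨J, fun j ρ hρ => (hJ j ρ (hS hρ)).trans (hD j ρ hρ)⟩
  · rintro ⟨J, hJ⟩
    choose Φ hΦ using exists_marginal_channel J
    exact ⟨Φ, ⟨J, fun j ρ _ => (hΦ j ρ).symm⟩, fun j ρ hρ => (hΦ j ρ).trans (hJ j ρ hρ)⟩

theorem CompatibleOn.mono {S T : Set (Matrix n n ℂ)} {D : ∀ i, Channel n (out i)}
    (h : CompatibleOn T D) (hST : S ⊆ T) : CompatibleOn S D := by
  obtain ⟨D', hD', h⟩ := h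
  exact ⟨D', hD', fun j ρ hρ => h j ρ (hST hρ)⟩

theorem Compatible.compatibleOn {D : ∀ i, Channel n (out i)} (h : Compatible D)
    (S : Set (Matrix n n ℂ)) : CompatibleOn S D :=
  ⟨D, h, fun _ _ _ => rfl⟩

end Marginal

/-! ### Local operators and the no-broadcasting theorem -/

section Local

variable {n κ r : Type*} [Fintype n] [Fintype κ] [Fintype r] [DecidableEq r]

/-- An operator on one tensor factor, acting on the whole space. -/
def localOp (f : κ ≃ n × r) : Matrix n n ℂ →⋆ₙₐ[ℂ] Matrix κ κ ℂ where
  toFun Q := (kroneckerMap (· * ·) Q (1 : Matrix r r ℂ)).submatrix f f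
  map_smul' c Q := by rw [smul_kronecker]; rfl
  map_zero' := by rw [zero_kronecker]; rfl
  map_add' Q S := by rw [add_kronecker]; rfl
  map_mul' Q S := by rw [submatrix_mul_equiv, ← mul_kronecker_mul, Matrix.one_mul]
  map_star' Q := by
    rw [star_eq_conjTranspose, star_eq_conjTranspose, conjTranspose_submatrix,
      conjTranspose_kronecker, conjTranspose_one]

theorem localOp_apply (f : κ ≃ n × r) (Q : Matrix n n ℂ) (k l : κ) :
    localOp f Q k l = Q (f k).1 (f l).1 * (1 : Matrix r r ℂ) (f k).2 (f l).2 := rfl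

/-- Partial trace is dual to the embedding of local operators; this turns a condition on marginals
into the trace identities of the core argument. -/
theorem trace_localOp_mul (f : κ ≃ n × r) (Q : Matrix n n ℂ) (M : Matrix κ κ ℂ) :
    (localOp f Q * M).trace
      = (Q * of fun b a => ∑ y, M (f.symm (b, y)) (f.symm (a, y))).trace := by
  simp only [trace, diag, Matrix.mul_apply, of_apply, localOp_apply]
  rw [← f.symm.sum_comp]
  simp only [← f.symm.sum_comp, Equiv.apply_symm_apply, Fintype.sum_prod_type, one_apply]
  simp only [mul_ite, mul_one, mul_zero, ite_mul, zero_mul, Finset.sum_ite_eq, Finset.mem_univ,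
    if_true, Finset.mul_sum]
  exact Finset.sum_congr rfl fun _ _ => Finset.sum_comm

end Local

section Broadcast

variable {n χ : Type*} [Fintype n] [DecidableEq n] [Fintype χ] [DecidableEq χ]

/-- The `j`-th factor of `ℂ^n ⊗ ℂ^n`, split off an environment and the other factor. -/
def splitFactor (χ n : Type*) (j : Fin 2) :
    χ × (Fin 2 → n) ≃ n × (χ × ({i : Fin 2 // i ≠ j} → n)) :=
  ((Equiv.refl χ).prodCongr (Equiv.piSplitAt j fun _ => n)).trans
    ((Equiv.prodAssoc _ _ _).symm.trans
      (((Equiv.prodComm _ _).prodCongr (Equiv.refl _)).trans (Equiv.prodAssoc _ _ _)))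

theorem localOp_splitFactor_zero_apply (Q : Matrix n n ℂ) (k l : χ × (Fin 2 → n)) :
    localOp (splitFactor χ n 0) Q k l
      = Q (k.2 0) (l.2 0) * if k.1 = l.1 ∧ k.2 1 = l.2 1 then 1 else 0 := by
  rw [localOp_apply, one_apply]
  congr 2
  simp [splitFactor, Prod.ext_iff, funext_iff, Fin.forall_fin_two]

theorem localOp_splitFactor_one_apply (Q : Matrix n n ℂ) (k l : χ × (Fin 2 → n)) :
    localOp (splitFactor χ n 1) Q k l
      = Q (k.2 1) (l.2 1) * if k.1 = l.1 ∧ k.2 0 = l.2 0 then 1 else 0 := by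
  rw [localOp_apply, one_apply]
  congr 2
  simp [splitFactor, Prod.ext_iff, funext_iff, Fin.forall_fin_two]

theorem commute_localOp (Q S : Matrix n n ℂ) :
    Commute (localOp (splitFactor χ n 0) Q) (localOp (splitFactor χ n 1) S) := by
  have hf : ∀ (p : Fin 2 → n) a b, p = ![a, b] ↔ p 0 = a ∧ p 1 = b := fun p a b => by
    simp [funext_iff, Fin.forall_fin_two]
  ext k l
  -- In each order only one intermediate index survives: each operator changes just its own
  -- coordinate.
  rw [Matrix.mul_apply, Matrix.mul_apply,
    Finset.sum_eq_single (k.1, ![l.2 0, k.2 1]), Finset.sum_eq_single (k.1, ![k.2 0, l.2 1])]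
  · simp only [localOp_splitFactor_zero_apply, localOp_splitFactor_one_apply]
    simp [mul_comm]
  · intro q _ hq
    simp only [localOp_splitFactor_zero_apply, localOp_splitFactor_one_apply]
    simp only [ne_eq, Prod.ext_iff, hf] at hq
    split_ifs <;> simp_all
  · simp
  · intro q _ hq
    simp only [localOp_splitFactor_zero_apply, localOp_splitFactor_one_apply]
    simp only [ne_eq, Prod.ext_iff, hf] at hq
    split_ifs <;> simp_all
  · simp

/-- Broadcastable states commute. -/
theorem commute_of_broadcast (B : Channel n (Fin 2 → n)) {ρ σ : Matrix n n ℂ}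
    (hρ : ρ.PosSemidef) (hσ : σ.PosSemidef) (hBρ : ∀ j : Fin 2, marginal j (B ρ) = ρ)
    (hBσ : ∀ j : Fin 2, marginal j (B σ) = σ) : Commute ρ σ := by
  obtain ⟨K, hK⟩ := B.exists_kraus
  -- Stinespring dilation: the Kraus index `n × (Fin 2 → n)` becomes the environment.
  let V : Matrix ((n × (Fin 2 → n)) × (Fin 2 → n)) n ℂ := of fun k i => K k.1 k.2 i
  have hVA : ∀ (A : Matrix n n ℂ) x p q, (V * A * Vᴴ) (x, p) (x, q) = (K x * A * (K x)ᴴ) p q :=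
    fun A x p q => rfl
  have hV : Vᴴ * V = 1 := by
    have h1 := sum_conjTranspose_mul_eq_one K fun A => by rw [← hK, B.trace_map']
    rw [← h1]
    ext i j
    simp only [Matrix.mul_apply, Matrix.sum_apply, conjTranspose_apply, V, of_apply,
      Fintype.sum_prod_type]
  have htr : ∀ (j : Fin 2) (A : Matrix n n ℂ), marginal j (B A) = A → ∀ Q,
      (localOp (splitFactor _ n j) Q * (V * A * Vᴴ)).trace = (Q * A).trace := by
    intro j A hA Q
    rw [trace_localOp_mul]
    congr 2
    ext b a
    conv_rhs => rw [← hA, marginal_apply, hK]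
    rw [of_apply, Fintype.sum_prod_type, Finset.sum_comm]
    refine Finset.sum_congr rfl fun y _ => ?_
    rw [Matrix.sum_apply]
    rfl
  exact commute_of_commuting_dilations hV (localOp (splitFactor _ n 0))
    (localOp (splitFactor _ n 1)) commute_localOp hρ hσ (htr 0 ρ (hBρ 0)) (htr 1 ρ (hBρ 1))
    (htr 0 σ (hBσ 0)) (htr 1 σ (hBσ 1))

end Broadcast
-- Affine dimension of commuting families of states
section Affine

variable {n : Type*} [Fintype n] [DecidableEq n]

/-- Joint eigenspaces of commuting symmetric operators span the space, so a basis can be chosen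
among joint eigenvectors; symmetry makes the eigenvalues real. -/
theorem exists_joint_eigenbasis {S : Set (Matrix n n ℂ)} (hS : ∀ ρ ∈ S, ρ.IsHermitian)
    (hc : ∀ ρ ∈ S, ∀ σ ∈ S, Commute ρ σ) :
    ∃ b : Module.Basis n ℂ (EuclideanSpace ℂ n),
      ∀ ρ ∈ S, ∀ i, ∃ c : ℝ, toEuclideanLin ρ (b i) = (c : ℂ) • b i := by
  let T : S → EuclideanSpace ℂ n →ₗ[ℂ] EuclideanSpace ℂ n := fun ρ => toEuclideanLin ρ.1
  have hT : ∀ ρ, (T ρ).IsSymmetric := fun ρ => isSymmetric_toEuclideanLin_iff.mpr (hS ρ.1 ρ.2)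
  have hTc : Pairwise (Function.onFun Commute T) := fun ρ σ _ => by
    change toEuclideanLin ρ.1 ∘ₗ toEuclideanLin σ.1 = toEuclideanLin σ.1 ∘ₗ toEuclideanLin ρ.1
    rw [toEuclideanLin, ← toLpLin_mul_same, ← toLpLin_mul_same, (hc ρ.1 ρ.2 σ.1 σ.2).eq]
  let E : Set (EuclideanSpace ℂ n) := {v | ∀ ρ, ∃ c : ℂ, T ρ v = c • v}
  have hE : ⊤ ≤ Submodule.span ℂ E := by
    rw [← LinearMap.IsSymmetric.iSup_iInf_eq_top_of_commute hT hTc]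
    refine iSup_le fun χ v hv => Submodule.subset_span fun ρ => ⟨χ ρ, ?_⟩
    exact Module.End.mem_eigenspace_iff.mp ((Submodule.mem_iInf _).mp hv ρ)
  let b₀ := Module.Basis.ofSpan hE
  have hb₀ : ∀ x, b₀ x ∈ E := fun x => Module.Basis.ofSpan_subset hE (Set.mem_range_self x)
  let b := b₀.reindex (b₀.indexEquiv (EuclideanSpace.basisFun n ℂ).toBasis)
  refine ⟨b, fun ρ hρ i => ?_⟩
  have hbi : b i ∈ E := by
    rw [Module.Basis.reindex_apply]; exact hb₀ _
  obtain ⟨c, hcv⟩ := hbi ⟨ρ, hρ⟩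
  have hev : Module.End.HasEigenvalue (T ⟨ρ, hρ⟩) c :=
    Module.End.hasEigenvalue_of_hasEigenvector
      ⟨Module.End.mem_eigenspace_iff.mpr hcv, b.ne_zero i⟩
  have hre := Complex.conj_eq_iff_re.mp ((hT ⟨ρ, hρ⟩).conj_eigenvalue_eq_self hev)
  exact ⟨c.re, by rw [hre]; exact hcv⟩

/-- Commuting Hermitian matrices span a real space of dimension at most the matrix size. -/
theorem finrank_span_le_of_commute {S : Set (Matrix n n ℂ)} (hS : ∀ ρ ∈ S, ρ.IsHermitian)
    (hc : ∀ ρ ∈ S, ∀ σ ∈ S, Commute ρ σ) :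
    Module.finrank ℝ (Submodule.span ℝ S) ≤ Fintype.card n := by
  obtain ⟨b, hb⟩ := exists_joint_eigenbasis hS hc
  have hspan : ∀ A ∈ Submodule.span ℝ S, ∀ i, ∃ c : ℝ, toEuclideanLin A (b i) = (c : ℂ) • b i := by
    intro A hA i
    induction hA using Submodule.span_induction with
    | mem ρ hρ => exact hb ρ hρ i
    | zero => exact ⟨0, by simp⟩
    | add A B _ _ hA hB =>
      obtain ⟨c, hc⟩ := hA
      obtain ⟨e, he⟩ := hB
      exact ⟨c + e, by rw [map_add, LinearMap.add_apply, hc, he, Complex.ofReal_add, add_smul]⟩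
    | smul r A _ hA =>
      obtain ⟨c, hc⟩ := hA
      refine ⟨r * c, ?_⟩
      rw [show r • A = (r : ℂ) • A from rfl, map_smul, LinearMap.smul_apply, hc, smul_smul,
        Complex.ofReal_mul]
  -- `f` reads off the real parts of the diagonal entries in the basis `b`. On the real span the
  -- matrices are diagonal with real entries there, so `f` is injective.
  let f : Matrix n n ℂ →ₗ[ℝ] n → ℝ := LinearMap.pi fun i =>
    Complex.reLm ∘ₗ ((b.coord i ∘ₗ LinearMap.applyₗ (b i) ∘ₗ
      (toEuclideanLin : Matrix n n ℂ ≃ₗ[ℂ] _).toLinearMap).restrictScalars ℝ)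
  have hf : ∀ A i, f A i = (b.repr (toEuclideanLin A (b i)) i).re := fun _ _ => rfl
  have hinj : Function.Injective (f ∘ₗ (Submodule.span ℝ S).subtype) := by
    rw [← LinearMap.ker_eq_bot, LinearMap.ker_eq_bot']
    rintro ⟨A, hA⟩ h0
    have hA0 : toEuclideanLin A = 0 := b.ext fun i => by
      obtain ⟨c, hc⟩ := hspan A hA i
      have h1 : f A i = 0 := congrFun h0 i
      rw [hf, hc, map_smul] at h1
      simp only [Finsupp.smul_apply, Module.Basis.repr_self, Finsupp.single_eq_same, smul_eq_mul,
        mul_one, Complex.ofReal_re] at h1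
      rw [hc, h1]; simp
    exact Subtype.ext (by simpa using hA0)
  simpa using LinearMap.finrank_le_finrank_of_injective hinj

/-- Differences of states have trace zero, so the direction space omits every state and is strictly
smaller than the linear span; this absorbs the `+ 1`. -/
theorem affineSize_le_finrank_span {S : Set (Matrix n n ℂ)} (hS : S ⊆ states n) :
    affineSize S ≤ Module.finrank ℝ (Submodule.span ℝ S) := by
  rw [affineSize]
  split_ifs with hne
  · obtain ⟨ρ, hρ⟩ := hne
    have htr : ∀ A ∈ vectorSpan ℝ S, A.trace = 0 := by
      intro A hA
      rw [vectorSpan_def] at hA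
      induction hA using Submodule.span_induction with
      | mem A hA =>
        obtain ⟨σ, hσ, τ, hτ, rfl⟩ := hA
        simp [(hS hσ).2, (hS hτ).2]
      | zero => simp
      | add A B _ _ hA hB => rw [trace_add, hA, hB, add_zero]
      | smul r A _ hA => rw [trace_smul, hA, smul_zero]
    apply Nat.succ_le_of_lt
    apply Submodule.finrank_lt_finrank_of_lt
    refine lt_of_le_of_ne ?_ fun h => ?_
    · rw [vectorSpan_def, Submodule.span_le]
      rintro _ ⟨σ, hσ, τ, hτ, rfl⟩
      exact Submodule.sub_mem _ (Submodule.subset_span hσ) (Submodule.subset_span hτ)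
    · have h1 := htr ρ (h ▸ Submodule.subset_span hρ)
      rw [(hS hρ).2] at h1
      exact one_ne_zero h1
  · exact Nat.zero_le _

theorem affineSize_le_of_commute {S : Set (Matrix n n ℂ)} (hS : S ⊆ states n)
    (hc : ∀ ρ ∈ S, ∀ σ ∈ S, Commute ρ σ) : affineSize S ≤ Fintype.card n :=
  (affineSize_le_finrank_span hS).trans
    (finrank_span_le_of_commute (fun _ hρ => (hS hρ).1.isHermitian) hc)

theorem affineSize_range {ι : Type*} [Fintype ι] [Nonempty ι] {p : ι → Matrix n n ℂ}
    (hp : AffineIndependent ℝ p) : affineSize (Set.range p) = Fintype.card ι := by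
  rw [affineSize, if_pos (Set.range_nonempty p), hp.finrank_vectorSpan_add_one]

theorem subsingleton_of_affineSize_le_one {S : Set (Matrix n n ℂ)} (h : affineSize S ≤ 1) :
    S.Subsingleton := by
  intro ρ hρ σ hσ
  rw [affineSize, if_pos ⟨ρ, hρ⟩] at h
  have h0 : Module.finrank ℝ (vectorSpan ℝ S) = 0 := by omega
  have h1 := vsub_mem_vectorSpan ℝ hρ hσ
  rw [Submodule.finrank_eq_zero.mp h0, Submodule.mem_bot, vsub_eq_sub, sub_eq_zero] at h1
  exact h1

theorem affineSize_pair {ρ σ : Matrix n n ℂ} (h : ρ ≠ σ) : affineSize {ρ, σ} = 2 := by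
  have := affineSize_range (affineIndependent_of_ne ℝ h)
  simpa [Set.pair_comm] using this

end Affine

/-! ### Measure-and-prepare channels and examples of states -/

section Prepare

variable {m n : Type*} [Fintype m] [DecidableEq m] [Fintype n] [DecidableEq n]

/-- Measuring an observable `A` and preparing the state `σ i` on outcome `i` is a channel. -/
theorem exists_measure_prepare {k : ℕ} {A : Fin k → Matrix m m ℂ} {σ : Fin k → Matrix n n ℂ}
    (hA : ∀ i, (A i).PosSemidef) (hA1 : ∑ i, A i = 1) (hσ : ∀ i, σ i ∈ states n) :
    ∃ Φ : Channel m n, ∀ ρ, Φ ρ = ∑ i, (ρ * A i).trace • σ i := by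
  choose L hL using fun i => exists_eq_star_mul_self_of_nonneg (hA i).nonneg
  choose G hG using fun i => exists_eq_star_mul_self_of_nonneg (hσ i).1.nonneg
  -- Rank-one Kraus operators, pairing a row of the factor `L` of the effect with a row of the
  -- factor `G` of the prepared state.
  let K : Fin k × m × n → Matrix n m ℂ := fun x =>
    vecMulVec (fun a => star (G x.1 x.2.2 a)) (L x.1 x.2.1)
  have hK : ∀ ρ : Matrix m m ℂ, ∑ x, K x * ρ * (K x)ᴴ = ∑ i, (ρ * A i).trace • σ i := by
    intro ρ
    rw [Fintype.sum_prod_type]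
    refine Finset.sum_congr rfl fun i _ => ?_
    have h1 : (ρ * A i).trace = ∑ c, (L i c) ᵥ* ρ ⬝ᵥ star (L i c) := by
      rw [hL i, star_eq_conjTranspose, ← mul_assoc, trace_mul_comm, ← mul_assoc]
      rfl
    rw [h1]
    ext a b
    have h2 : σ i a b = ∑ e, star (G i e a) * G i e b := congrFun (congrFun (hG i) a) b
    rw [Matrix.smul_apply, h2, Matrix.sum_apply, Fintype.sum_prod_type, smul_eq_mul,
      Finset.sum_mul]
    refine Finset.sum_congr rfl fun c _ => ?_
    rw [Finset.mul_sum]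
    refine Finset.sum_congr rfl fun e _ => ?_
    simp only [K]
    rw [vecMulVec_mul, conjTranspose_vecMulVec, vecMulVec_mul_vecMulVec]
    simp only [vecMulVec_apply, Pi.smul_apply, Pi.star_apply, smul_eq_mul, star_star]
    ring
  refine ⟨Channel.ofKraus K (sum_conjTranspose_mul_eq_one K fun ρ => ?_), hK⟩
  rw [hK, trace_sum]
  simp only [trace_smul, (hσ _).2, smul_eq_mul, mul_one]
  rw [← trace_sum, ← Matrix.mul_sum, hA1, mul_one]

/-- The product state `ρ ⊗ ρ`. -/
def prodState (ρ : Matrix n n ℂ) : Matrix (Fin 2 → n) (Fin 2 → n) ℂ :=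
  of fun x y => ρ (x 0) (y 0) * ρ (x 1) (y 1)

theorem prodState_mem_states {ρ : Matrix n n ℂ} (hρ : ρ ∈ states n) :
    prodState ρ ∈ states (Fin 2 → n) := by
  refine ⟨(hρ.1.kronecker hρ.1).submatrix fun x : Fin 2 → n => (x 0, x 1), ?_⟩
  have h := hρ.2
  simp only [trace, diag] at h
  simp only [trace, diag, prodState, of_apply]
  rw [← (finTwoArrowEquiv n).symm.sum_comp, Fintype.sum_prod_type]
  simp [← Finset.mul_sum, h]

theorem marginal_prodState {ρ : Matrix n n ℂ} (hρ : ρ ∈ states n) (j : Fin 2) :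
    marginal j (prodState ρ) = ρ := by
  have h := hρ.2
  simp only [trace, diag] at h
  ext a b
  rw [marginal, of_apply, ← (finTwoArrowEquiv n).symm.sum_comp, Fintype.sum_prod_type]
  fin_cases j
  · simp [prodState, ← Finset.mul_sum, h]
  · simp [prodState, ← Finset.sum_mul, h]

theorem compatibleOn_of_perfectlyDistinguishable {k : ℕ} {ρ : Fin k → Matrix n n ℂ}
    (hρ : ∀ i, ρ i ∈ states n) (h : PerfectlyDistinguishable ρ) :
    CompatibleOn (Set.range ρ) (fun _ : Fin 2 => Channel.id n) := by
  obtain ⟨A, hA, hA1, hAρ⟩ := h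
  obtain ⟨Φ, hΦ⟩ := exists_measure_prepare hA hA1 fun i => prodState_mem_states (hρ i)
  rw [compatibleOn_iff (Set.range_subset_iff.mpr hρ)]
  refine ⟨Φ, ?_⟩
  rintro j _ ⟨i, rfl⟩
  have : Φ (ρ i) = prodState (ρ i) := by
    rw [hΦ]; simp [hAρ]
  rw [this, marginal_prodState (hρ i)]
  rfl

/-- One state is perfectly distinguishable by the trivial one-outcome observable, and the empty set
inherits compatibility from any singleton. -/
theorem compatibleOn_of_subsingleton {S : Set (Matrix n n ℂ)} (hS : S ⊆ states n)
    (hne : (states n).Nonempty) (h : S.Subsingleton) :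
    CompatibleOn S (fun _ : Fin 2 => Channel.id n) := by
  have hone : ∀ ρ ∈ states n, CompatibleOn {ρ} (fun _ : Fin 2 => Channel.id n) := fun ρ hρ => by
    have := compatibleOn_of_perfectlyDistinguishable (ρ := fun _ : Fin 1 => ρ) (fun _ => hρ)
      ⟨fun _ => 1, fun _ => PosSemidef.one, by simp, fun i j => by
        simp [hρ.2, Subsingleton.elim i j]⟩
    rwa [Set.range_const] at this
  rcases h.eq_empty_or_singleton with rfl | ⟨ρ, rfl⟩
  · obtain ⟨ρ, hρ⟩ := hne
    exact (hone ρ hρ).mono (Set.empty_subset _)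
  · exact hone ρ (hS rfl)

theorem single_mem_states (i : n) : single i i (1 : ℂ) ∈ states n := by
  refine ⟨?_, by simp⟩
  rw [← diagonal_single]
  refine PosSemidef.diagonal fun j => ?_
  by_cases h : j = i
  · subst h; simp
  · simp [h]

theorem perfectlyDistinguishable_single (d : ℕ) :
    PerfectlyDistinguishable fun i : Fin d => single i i (1 : ℂ) := by
  refine ⟨fun i => single i i 1, fun i => (single_mem_states i).1, ?_, fun i j => ?_⟩
  · ext a b
    by_cases h : a = b
    · subst h; simp [Matrix.sum_apply, single_apply]
    · rw [Matrix.sum_apply, one_apply_ne h]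
      exact Finset.sum_eq_zero fun i _ => by
        rw [single_apply, if_neg fun hi => h (hi.1.symm.trans hi.2)]
  · by_cases h : i = j
    · subst h; simp
    · simp [h]

theorem affineIndependent_single (n : Type*) [Fintype n] [DecidableEq n] :
    AffineIndependent ℝ fun i : n => single i i (1 : ℂ) := by
  apply LinearIndependent.affineIndependent
  rw [Fintype.linearIndependent_iff]
  intro g hg i
  have := congrFun (congrFun hg i) i
  simpa [Matrix.sum_apply, single_apply] using this

theorem exists_noncommuting_states {p q : n} (hpq : p ≠ q) :
    ∃ ρ ∈ states n, ∃ σ ∈ states n, ¬ Commute ρ σ := by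
  -- The weights 3/5 and 4/5 form a rational unit vector with both entries nonzero, so its
  -- projection has a nonzero off-diagonal entry.
  let u : n → ℂ := Pi.single p (3 / 5) + Pi.single q (4 / 5)
  have hup : u p = 3 / 5 := by simp [u, hpq]
  have huq : u q = 4 / 5 := by simp [u, hpq.symm]
  refine ⟨_, single_mem_states p, vecMulVec u (star u),
    ⟨posSemidef_vecMulVec_self_star u, ?_⟩, fun h => ?_⟩
  · rw [trace_vecMulVec]
    simp [u, hpq, hpq.symm]
    norm_num
  · have := congrFun (congrFun h.eq p) q
    rw [single_mul_apply_same, mul_single_apply_of_ne _ _ _ _ _ hpq.symm] at this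
    simp [vecMulVec_apply, hup, huq] at this

end Prepare
end QDevice

/-! ### The main theorem -/

open QDevice in
theorem mainTheorem6 (d : ℕ) :
    (∀ S₀ ⊆ QDevice.states (Fin d),
      (QDevice.CompatibleOn S₀ (QDevice.identityPair d) ↔ QDevice.Broadcastable S₀) ∧
      ((∃ ρ ∈ S₀, ∃ σ ∈ S₀, ¬ Commute ρ σ) →
        ¬ QDevice.CompatibleOn S₀ (QDevice.identityPair d)) ∧
      ((∀ ρ ∈ S₀, ∀ σ ∈ S₀, Commute ρ σ) → QDevice.affineSize S₀ ≤ d)) ∧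
    (∀ (k : ℕ) (ρ : Fin k → Matrix (Fin d) (Fin d) ℂ), (∀ i, ρ i ∈ QDevice.states (Fin d)) →
      QDevice.PerfectlyDistinguishable ρ →
        QDevice.CompatibleOn (Set.range ρ) (QDevice.identityPair d)) ∧
    (2 ≤ d →
      ¬ QDevice.Compatible (QDevice.identityPair d) ∧
      QDevice.IsIncompatibilityDim (QDevice.identityPair d) 2 ∧
      QDevice.IsCompatibilityDim (QDevice.identityPair d) d) := by
  have hbr : ∀ S₀ ⊆ states (Fin d), (CompatibleOn S₀ (identityPair d) ↔ Broadcastable S₀) := by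
    intro S₀ hS
    rw [compatibleOn_iff hS]
    exact exists_congr fun J => ⟨fun h ρ hρ j => h j ρ hρ, fun h j ρ hρ => h ρ hρ j⟩
  have hcomm : ∀ S₀ ⊆ states (Fin d), CompatibleOn S₀ (identityPair d) →
      ∀ ρ ∈ S₀, ∀ σ ∈ S₀, Commute ρ σ := by
    intro S₀ hS h ρ hρ σ hσ
    obtain ⟨B, hB⟩ := (hbr S₀ hS).mp h
    exact commute_of_broadcast B (hS hρ).1 (hS hσ).1 (hB ρ hρ) (hB σ hσ)
  have hsize : ∀ S₀ ⊆ states (Fin d), (∀ ρ ∈ S₀, ∀ σ ∈ S₀, Commute ρ σ) → affineSize S₀ ≤ d :=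
    fun S₀ hS h => by simpa using affineSize_le_of_commute hS h
  refine ⟨fun S₀ hS => ⟨hbr S₀ hS, ?_, hsize S₀ hS⟩,
    fun k ρ hρ h => compatibleOn_of_perfectlyDistinguishable hρ h, fun hd => ?_⟩
  · rintro ⟨ρ, hρ, σ, hσ, hn⟩ h
    exact hn (hcomm S₀ hS h ρ hρ σ hσ)
  have : NeZero d := ⟨by omega⟩
  obtain ⟨ρ, hρ, σ, hσ, hn⟩ := exists_noncommuting_states (n := Fin d) (p := ⟨0, by omega⟩)
    (q := ⟨1, by omega⟩) (by simp)
  have hsub : {ρ, σ} ⊆ states (Fin d) := Set.pair_subset hρ hσ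
  have hinc : ¬ CompatibleOn {ρ, σ} (identityPair d) := fun h =>
    hn (hcomm _ hsub h ρ (by simp) σ (by simp))
  refine ⟨fun h => hinc (h.compatibleOn _), ⟨⟨_, hsub, hinc, affineSize_pair ?_⟩, ?_⟩,
    ⟨⟨_, Set.range_subset_iff.mpr single_mem_states, compatibleOn_of_perfectlyDistinguishable
      single_mem_states (perfectlyDistinguishable_single d), ?_⟩, ?_⟩⟩
  · rintro rfl; exact hn (Commute.refl _)
  -- Affine size below 2 means at most one state, and a single state can always be broadcast.
  · rintro _ ⟨S, hS, hni, rfl⟩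
    by_contra hlt
    exact hni (compatibleOn_of_subsingleton hS ⟨ρ, hρ⟩
      (subsingleton_of_affineSize_le_one (by omega)))
  · simpa using affineSize_range (affineIndependent_single (Fin d))
  · rintro _ ⟨S, hS, hcS, rfl⟩
    exact hsize S hS (hcomm S hS hcS)
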